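/- Let $r,N\ge 0$ be integers and let $\lambda=(\lambda_1\ge\cdots\ge\lambda_r\ge 0)$ be a partition (with zero parts allowed) such that $\lambda_1\le N$. For $j\ge 0$ let $m_j$ be the number of indices $i$ with $\lambda_i=j$. **The model.** Consider the rectangular grid with $r$ rows, numbered $1,\dots,r$ from top to bottom, and $N+1$ columns, numbered $0,\dots,N$ from right to left. Horizontal edges carry spins in $\{+,-\}$ and vertical edges carry spins in $\mathbb{N}=\{0,1,2,\dots\}$. The boundary spins are: $+$ on every left edge, $-$ on every right edge, $m_j$ on the top edge of column $j$, and $0$ on every bottom edge. A state of the system $\mathfrak{S}_\lambda(\mathbf z;t)$ is an assignment of spins to all edges with these boundary values. The local weight of a vertex in row $i$ depends on its (left, top, right, bottom) spins and is, for $n\ge 0$, | (left, top, right, bottom) | $(+,n,+,n)$ | $(-,n,-,n)$ | $(-,n,+,n+1)$ | $(+,n+1,-,n)$ | |---|---|---|---|---| | $P$-weight | $1$ | $z_i$ | $z_i(1-t^{n+1})$ | $1$ | | $R$-weight | $1$ | $z_i$ | $z_i(1-t)$ | $\frac{1-t^{n+1}}{1-t}=1+t+\cdots+t^n$ | and $0$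 for every other configuration. The weight of a state is the product of the local weights of all vertices, and $Z_P(\mathfrak{S}_\lambda(\mathbf z;t))$, $Z_R(\mathfrak{S}_\lambda(\mathbf z;t))$ are the sums over all states of the weights formed with the $P$-weights and the $R$-weights, respectively (only finitely many states have nonzero weight). **Hall–Littlewood polynomials.** In the field of rational functions in indeterminates $z_1,\dots,z_r,t$ put $$R_\lambda(\mathbf z;t)=\sum_{w\in S_r} w\Bigl(z_1^{\lambda_1}\cdots z_r^{\lambda_r}\prod_{i<j}\frac{z_i-tz_j}{z_i-z_j}\Bigr),\qquad P_\lambda(\mathbf z;t)=\frac{R_\lambda(\mathbf z;t)}{v_\lambda(t)},\qquad v_\lambda(t)=\prod_{j\ge 0}\prod_{i=1}^{m_j}\frac{1-t^i}{1-t},$$ where $w$ acts by permuting $z_1,\dots,z_r$. **Theorem.** As rational functions in the indeterminates $z_1,\dots,z_r,t$, $$Z_P(\mathfrak{S}_\lambda(\mathbf z;t))=P_\lambda(z_1,\dots,z_r;t),\qquad Z_R(\mathfrak{S}_\lambda(\mathbf z;t))=R_\lambda(z_1,\dots,z_r;t).$$ Moreover $P_\lambda$ and $R_\lambda$ are polynomials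 in $z_1,\dots,z_r,t$ with integer coefficients, and both identities hold for all values of $z_1,\dots,z_r,t$ in any commutative ring (in particular, in $\mathbb{C}$). -/

import Mathlib

namespace BosonicModel

open Polynomial

/-- Spins of horizontal edges. -/
inductive HSpin
  | plus
  | minus
  deriving DecidableEq

instance : Fintype HSpin where
  elems := {.plus, .minus}
  complete := by intro x; cases x <;> simp

/-- The polynomial `(1 - t ^ n) / (1 - t) = 1 + t + ⋯ + t ^ (n - 1)`, which makes sense for every
value of `t`, including `t = 1`. -/
def qInt {K : Type*} [CommRing K] (t : K) (n : ℕ) : K :=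
  ∑ i ∈ Finset.range n, t ^ i

theorem qInt_eq_div {K : Type*} [Field K] {t : K} (ht : t ≠ 1) (n : ℕ) :
    qInt t n = (1 - t ^ n) / (1 - t) := by
  have h : (1 : K) - t ≠ 0 := sub_ne_zero.mpr (Ne.symm ht)
  rw [eq_div_iff h, qInt, mul_comm, mul_neg_geom_sum]

/-- The `P`-weight of a vertex with parameter `z`, given the spins of its left, top, right and
bottom edges. The four cases are the patterns `A(n)`, `B(n)`, `C(n)`, `D(n)`; every other
configuration has weight zero. -/
def weightP {K : Type*} [CommRing K] (t z : K) (left : HSpin) (top : ℕ) (right : HSpin)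
    (bottom : ℕ) : K :=
  match left, right with
  | .plus, .plus => if bottom = top then 1 else 0
  | .minus, .minus => if bottom = top then z else 0
  | .minus, .plus => if bottom = top + 1 then z * (1 - t ^ (top + 1)) else 0
  | .plus, .minus => if top = bottom + 1 then 1 else 0

/-- The `R`-weight of a vertex with parameter `z`. -/
def weightR {K : Type*} [CommRing K] (t z : K) (left : HSpin) (top : ℕ) (right : HSpin)
    (bottom : ℕ) : K :=
  match left, right with
  | .plus, .plus => if bottom = top then 1 else 0
  | .minus, .minus => if bottom = top then z else 0
  | .minus, .plus => if bottom = top + 1 then z * (1 - t) else 0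
  | .plus, .minus => if top = bottom + 1 then qInt t (bottom + 1) else 0

/-- The number `m_j` of parts of `lam` equal to `j`. -/
def mult {r : ℕ} (lam : Fin r → ℕ) (j : ℕ) : ℕ :=
  (Finset.univ.filter fun i => lam i = j).card

/-- A state of the uncolored system attached to `lam` on a grid with `r` rows, numbered from top
to bottom, and columns `0, …, N`, numbered from right to left.
* `h i k` is the spin of the `k`-th horizontal edge of row `i`, counted from the right: the vertex
  in row `i` and column `j` lies between the edges `j + 1` (on its left) and `j` (on its right).
* `v k j` is the spin of the `k`-th vertical edge of column `j`, counted from the top: the vertex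
  in row `i` and column `j` lies between the edges `i` (above) and `i + 1` (below). -/
@[ext]
structure State (r N : ℕ) (lam : Fin r → ℕ) where
  h : Fin r → Fin (N + 2) → HSpin
  v : Fin (r + 1) → Fin (N + 1) → ℕ
  left_boundary : ∀ i, h i (Fin.last (N + 1)) = .plus
  right_boundary : ∀ i, h i 0 = .minus
  top_boundary : ∀ j, v 0 j = mult lam j
  bottom_boundary : ∀ j, v (Fin.last r) j = 0

/-- The Boltzmann weight of a state: the product of the local weights of all vertices, where `w`
is a system of local weights and `z i` is the parameter of the vertices in row `i`. -/
def State.weight {r N : ℕ} {lam : Fin r → ℕ} {K : Type*} [CommRing K]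
    (w : K → HSpin → ℕ → HSpin → ℕ → K) (z : Fin r → K) (s : State r N lam) : K :=
  ∏ i : Fin r, ∏ j : Fin (N + 1),
    w (z i) (s.h i j.succ) (s.v i.castSucc j) (s.h i j.castSucc) (s.v i.succ j)

/-- The partition function: the sum of the Boltzmann weights of all states. Only finitely many of
them are nonzero for the `P`- and `R`-weights (`finite_support_weightP`,
`finite_support_weightR`). -/
noncomputable def partitionFunction {r : ℕ} (N : ℕ) (lam : Fin r → ℕ) {K : Type*} [CommRing K]
    (w : K → HSpin → ℕ → HSpin → ℕ → K) (z : Fin r → K) : K :=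
  ∑ᶠ s : State r N lam, s.weight w z

/-- The partition function `Z_P` for the `P`-weights. -/
noncomputable def ZP {r : ℕ} (N : ℕ) (lam : Fin r → ℕ) {K : Type*} [CommRing K]
    (z : Fin r → K) (t : K) : K :=
  partitionFunction N lam (weightP t) z

/-- The partition function `Z_R` for the `R`-weights. -/
noncomputable def ZR {r : ℕ} (N : ℕ) (lam : Fin r → ℕ) {K : Type*} [CommRing K]
    (z : Fin r → K) (t : K) : K :=
  partitionFunction N lam (weightR t) z

theorem finite_support_weight {r N : ℕ} {lam : Fin r → ℕ} {K : Type*} [CommRing K]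
    (w : K → HSpin → ℕ → HSpin → ℕ → K) (z : Fin r → K)
    (hw : ∀ x a b c d, w x a b c d ≠ 0 → d ≤ b + 1) :
    (Function.support fun s : State r N lam => s.weight w z).Finite := by
  classical
  let f : State r N lam → (Fin r → Fin (N + 2) → HSpin) × (Fin (r + 1) → Fin (N + 1) → ℕ) :=
    fun s => (s.h, s.v)
  have hf : Function.Injective f := by
    intro s s' e
    exact State.ext (congrArg Prod.fst e) (congrArg Prod.snd e)
  refine Set.Finite.of_finite_image (f := f) ?_ hf.injOn
  have hfin : ((Set.univ : Set (Fin r → Fin (N + 2) → HSpin)) ×ˢ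
      (Set.Iic fun (_ : Fin (r + 1)) (_ : Fin (N + 1)) => r + r)).Finite :=
    Set.finite_univ.prod (Set.finite_Iic _)
  refine hfin.subset ?_
  rintro _ ⟨s, hs, rfl⟩
  refine ⟨Set.mem_univ _, ?_⟩
  have hs' : s.weight w z ≠ 0 := hs
  have hstep : ∀ (i : Fin r) (j : Fin (N + 1)), s.v i.succ j ≤ s.v i.castSucc j + 1 := by
    intro i j
    refine hw (z i) (s.h i j.succ) _ (s.h i j.castSucc) _ fun h0 => hs' ?_
    exact Finset.prod_eq_zero (Finset.mem_univ i) (Finset.prod_eq_zero (Finset.mem_univ j) h0)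
  have hb : ∀ (k : Fin (r + 1)) (j : Fin (N + 1)), s.v k j ≤ r + k := by
    intro k j
    induction k using Fin.induction with
    | zero =>
      rw [s.top_boundary j]
      have := Finset.card_filter_le (Finset.univ : Finset (Fin r)) fun i => lam i = j
      simpa [mult] using this
    | succ i ih =>
      have := hstep i j
      simp only [Fin.val_castSucc, Fin.val_succ] at ih ⊢
      omega
  intro k j
  have := hb k j
  have := k.is_lt
  change s.v k j ≤ r + r
  omega

theorem finite_support_weightP {r N : ℕ} {lam : Fin r → ℕ} {K : Type*} [CommRing K]
    (z : Fin r → K) (t : K) :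
    (Function.support fun s : State r N lam => s.weight (weightP t) z).Finite := by
  refine finite_support_weight _ z fun x a b c d h => ?_
  cases a <;> cases c <;> simp only [weightP, ne_eq, ite_eq_right_iff, Classical.not_imp] at h <;>
    omega

theorem finite_support_weightR {r N : ℕ} {lam : Fin r → ℕ} {K : Type*} [CommRing K]
    (z : Fin r → K) (t : K) :
    (Function.support fun s : State r N lam => s.weight (weightR t) z).Finite := by
  refine finite_support_weight _ z fun x a b c d h => ?_
  cases a <;> cases c <;> simp only [weightR, ne_eq, ite_eq_right_iff, Classical.not_imp] at h <;>
    omega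

/-- `∑_{w ∈ S_r} w (z^lam ∏_{i < j} (z_i - t z_j) / (z_i - z_j))`, where `w` permutes the `z_i`. -/
noncomputable def hallLittlewoodSum {r : ℕ} (lam : Fin r → ℕ) {K : Type*} [Field K]
    (z : Fin r → K) (t : K) : K :=
  ∑ w : Equiv.Perm (Fin r),
    (∏ i, z (w i) ^ lam i) *
      ∏ i, ∏ j ∈ Finset.Ioi i, (z (w i) - t * z (w j)) / (z (w i) - z (w j))

/-- `v_m(t) = ∏_{i = 1}^m (1 - t^i) / (1 - t)`. -/
noncomputable def vNum {K : Type*} [Field K] (t : K) (m : ℕ) : K :=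
  ∏ i ∈ Finset.Icc 1 m, (1 - t ^ i) / (1 - t)

/-- `v_lam(t) = ∏_j v_{m_j}(t)`, the product being over all `j ≥ 0` that occur in `lam` (the other
factors are `1`). -/
noncomputable def vLam {r : ℕ} (lam : Fin r → ℕ) {K : Type*} [Field K] (t : K) : K :=
  ∏ j ∈ Finset.univ.image lam, vNum t (mult lam j)

/-- The field of rational functions in indeterminates `z_1, …, z_r` and `t`. -/
abbrev RatField (r : ℕ) : Type := FractionRing (MvPolynomial (Fin r) ℤ[X])

/-- The indeterminate `z_i` in the field of rational functions. -/
noncomputable def genZ (r : ℕ) (i : Fin r) : RatField r :=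
  algebraMap (MvPolynomial (Fin r) ℤ[X]) (RatField r) (MvPolynomial.X i)

/-- The indeterminate `t` in the field of rational functions. -/
noncomputable def genT (r : ℕ) : RatField r :=
  algebraMap (MvPolynomial (Fin r) ℤ[X]) (RatField r) (MvPolynomial.C X)

/-- The Hall–Littlewood function `R_lam(z; t)`, a priori a rational function. -/
noncomputable def hallLittlewoodR {r : ℕ} (lam : Fin r → ℕ) : RatField r :=
  hallLittlewoodSum lam (genZ r) (genT r)

/-- The Hall–Littlewood function `P_lam(z; t) = v_lam(t)⁻¹ R_lam(z; t)`, a priori a rational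
function. -/
noncomputable def hallLittlewoodP {r : ℕ} (lam : Fin r → ℕ) : RatField r :=
  (vLam lam (genT r))⁻¹ * hallLittlewoodR lam

/-- The value of a polynomial in `z_1, …, z_r` and `t` at a point. -/
noncomputable def evalAt {r : ℕ} {K : Type*} [CommRing K] (z : Fin r → K) (t : K)
    (p : MvPolynomial (Fin r) ℤ[X]) : K :=
  MvPolynomial.eval₂ (Polynomial.eval₂RingHom (Int.castRingHom K) t) z p

end BosonicModel

namespace BosonicModel

open Equiv

/-! The heart is a one-row statement, the branching rule `hallLittlewoodSum_branching`: summing a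
row with parameter `z` against the Hall–Littlewood sums in `n` variables, indexed by its bottom
spins, gives the sum in `n + 1` variables indexed by its top spins. Peeling off the top row
(`sum_gridWeight_succ`) then yields the formula for `ZR` by induction on the number of rows.

For the branching rule, sort the permutations by the part that becomes the exponent of `z`. This
writes the larger sum as the symmetrization of `takePart` in the other variables against their own
kernel (`hallLittlewoodSum_cons`). The row is read from left to right: `rowPlus` and `rowMinus`
record what the columns `≥ c` contribute when the spin to their right is `+` or `-`. Adding one
column reproduces the four `R`-weights (`rowPlus_step`, `rowMinus_step`), but only after
symmetrization. The identities behind this are `(z - t * Y) / (z - Y) = t + (1 - t) * z / (z - Y)`,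
and the cancellation of a term that becomes alternating in two adjacent variables once multiplied by
their kernel factor (`rowPlus_succ_symmEq`).

The `P`- and `R`-weights differ by a change of gauge on vertical edges that telescopes to `vLam`
(`ZR_eq_vLam_mul_ZP`). This and the branching argument need generic parameters. Arbitrary rings are
reached because the partition functions commute with ring homomorphisms (`map_ZP`, `map_ZR`), so
those over the polynomial ring are universal. -/

/-- The factor `(a - t b) / (a - b)` of the Hall–Littlewood kernel. -/
def hlFactor {K : Type*} [Field K] (t a b : K) : K := (a - t * b) / (a - b)

/-- The Hall–Littlewood kernel `∏_{i < j} (x_i - t x_j) / (x_i - x_j)`. -/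
def hlKernel {K : Type*} [Field K] {n : ℕ} (t : K) (x : Fin n → K) : K :=
  ∏ i, ∏ j ∈ Finset.Ioi i, hlFactor t (x i) (x j)

/-- The entries of a tuple as a sequence indexed from `1`, continued by zeros. -/
def seqOf {K : Type*} [Field K] {n : ℕ} (y : Fin n → K) (i : ℕ) : K :=
  if h : i - 1 < n then y ⟨i - 1, h⟩ else 0

/-- The monomial `Y_k ^ l_0 * Y_{k + 1} ^ l_1 * ⋯`. -/
def listMonomial {K : Type*} [Field K] (Y : ℕ → K) : ℕ → List ℕ → K
  | _, [] => 1
  | k, c :: l => Y k ^ c * listMonomial Y (k + 1) l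

/-- The symmetrization of `ψ` against the Hall–Littlewood kernel. -/
def hlSymm {K : Type*} [Field K] {n : ℕ} (t : K) (x : Fin n → K) (ψ : (ℕ → K) → K) : K :=
  ∑ u : Perm (Fin n), ψ (seqOf (x ∘ u)) * hlKernel t (x ∘ u)

/-- `ψ` and `ψ'` have the same symmetrization after multiplication by any monomial in the variables
with index at least `k`. -/
def SymmEq {K : Type*} [Field K] {n : ℕ} (t : K) (x : Fin n → K) (k : ℕ)
    (ψ ψ' : (ℕ → K) → K) : Prop :=
  ∀ l, hlSymm t x (fun Y => ψ Y * listMonomial Y k l) =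
    hlSymm t x (fun Y => ψ' Y * listMonomial Y k l)

/-! ### Symmetrization against the Hall–Littlewood kernel -/

section Symm

variable {K : Type*} [Field K] {n : ℕ} {t : K} {x : Fin n → K}

theorem listMonomial_append (Y : ℕ → K) (k : ℕ) (l l' : List ℕ) :
    listMonomial Y k (l ++ l') = listMonomial Y k l * listMonomial Y (k + l.length) l' := by
  induction l generalizing k with
  | nil => simp [listMonomial]
  | cons c l ih =>
    simp only [List.cons_append, listMonomial, ih, List.length_cons, mul_assoc]
    rw [show k + 1 + l.length = k + (l.length + 1) by ring]

theorem listMonomial_replicate_succ (Y : ℕ → K) (k m c : ℕ) :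
    listMonomial Y k (List.replicate (m + 1) c) =
      listMonomial Y k (List.replicate m c) * Y (k + m) ^ c := by
  rw [List.replicate_succ', listMonomial_append]
  simp [listMonomial]

theorem listMonomial_congr {Y Y' : ℕ → K} {k : ℕ} (h : ∀ i, k ≤ i → Y i = Y' i) (l : List ℕ) :
    listMonomial Y k l = listMonomial Y' k l := by
  induction l generalizing k with
  | nil => rfl
  | cons c l ih =>
    simp only [listMonomial]
    rw [h k le_rfl, ih fun i hi => h i (by omega)]

theorem hlSymm_add (ψ φ : (ℕ → K) → K) :
    hlSymm t x (fun Y => ψ Y + φ Y) = hlSymm t x ψ + hlSymm t x φ := by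
  simp [hlSymm, add_mul, Finset.sum_add_distrib]

theorem hlSymm_sub (ψ φ : (ℕ → K) → K) :
    hlSymm t x (fun Y => ψ Y - φ Y) = hlSymm t x ψ - hlSymm t x φ := by
  simp [hlSymm, sub_mul, Finset.sum_sub_distrib]

theorem hlSymm_const_mul (a : K) (ψ : (ℕ → K) → K) :
    hlSymm t x (fun Y => a * ψ Y) = a * hlSymm t x ψ := by
  simp [hlSymm, mul_assoc, Finset.mul_sum]

theorem hlSymm_congr {ψ φ : (ℕ → K) → K} (h : ∀ u : Perm (Fin n),
    ψ (seqOf (x ∘ u)) = φ (seqOf (x ∘ u))) : hlSymm t x ψ = hlSymm t x φ := by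
  simp [hlSymm, h]

theorem SymmEq.of_eq {k : ℕ} {ψ φ : (ℕ → K) → K} (h : ∀ u : Perm (Fin n),
    ψ (seqOf (x ∘ u)) = φ (seqOf (x ∘ u))) : SymmEq t x k ψ φ := fun _ =>
  hlSymm_congr fun u => by rw [h u]

theorem SymmEq.trans {k : ℕ} {ψ φ χ : (ℕ → K) → K} (h : SymmEq t x k ψ φ)
    (h' : SymmEq t x k φ χ) : SymmEq t x k ψ χ := fun l => (h l).trans (h' l)

theorem SymmEq.add {k : ℕ} {ψ φ ψ' φ' : (ℕ → K) → K} (h : SymmEq t x k ψ φ)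
    (h' : SymmEq t x k ψ' φ') :
    SymmEq t x k (fun Y => ψ Y + ψ' Y) (fun Y => φ Y + φ' Y) := fun l => by
  simp only [add_mul, hlSymm_add, h l, h' l]

theorem SymmEq.const_mul {k : ℕ} {ψ φ : (ℕ → K) → K} (a : K) (h : SymmEq t x k ψ φ) :
    SymmEq t x k (fun Y => a * ψ Y) (fun Y => a * φ Y) := fun l => by
  simp only [mul_assoc, hlSymm_const_mul, h l]

theorem SymmEq.mul_pow {k : ℕ} {ψ φ : (ℕ → K) → K} (c : ℕ) (h : SymmEq t x k ψ φ) :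
    SymmEq t x (k + 1) (fun Y => ψ Y * Y k ^ c) (fun Y => φ Y * Y k ^ c) := fun l => by
  simpa only [listMonomial, mul_assoc] using h (c :: l)

theorem hlKernel_eq_prod_filter (y : Fin n → K) :
    hlKernel t y = ∏ q ∈ (Finset.univ : Finset (Fin n × Fin n)).filter (fun q => q.1 < q.2),
      hlFactor t (y q.1) (y q.2) := by
  rw [Finset.prod_filter, ← Finset.univ_product_univ, Finset.prod_product]
  refine Finset.prod_congr rfl fun i _ => ?_
  rw [← Finset.prod_filter]
  refine Finset.prod_congr ?_ fun _ _ => rfl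
  ext j; simp

/-- The part of the kernel that is unchanged by exchanging the adjacent positions `i` and `j`. -/
def hlKernelErase (t : K) (y : Fin n → K) (i j : Fin n) : K :=
  ∏ q ∈ ((Finset.univ : Finset (Fin n × Fin n)).filter (fun q => q.1 < q.2)).erase (i, j),
      hlFactor t (y q.1) (y q.2)

theorem hlKernel_eq_mul_erase (y : Fin n → K) {i j : Fin n} (h : i < j) :
    hlKernel t y = hlFactor t (y i) (y j) * hlKernelErase t y i j := by
  rw [hlKernel_eq_prod_filter, hlKernelErase]
  exact (Finset.mul_prod_erase _ (fun q : Fin n × Fin n => hlFactor t (y q.1) (y q.2))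
    (a := (i, j)) (by simpa using h)).symm

/-- An adjacent transposition reverses the order of no pair except the two positions it exchanges.
-/
theorem swap_lt_swap {i j : Fin n} (h : (j : ℕ) = i + 1) {a b : Fin n} (hab : a < b)
    (hne : (a, b) ≠ (i, j)) : swap i j a < swap i j b ∧ (swap i j a, swap i j b) ≠ (i, j) := by
  simp only [swap_apply_def, ne_eq, Prod.mk.injEq, Fin.lt_def, Fin.ext_iff] at *
  split_ifs <;> simp_all <;> omega

theorem hlKernelErase_comp_swap (y : Fin n → K) {i j : Fin n} (h : (j : ℕ) = i + 1) :
    hlKernelErase t (y ∘ swap i j) i j = hlKernelErase t y i j := by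
  unfold hlKernelErase
  refine Finset.prod_bij' (fun q _ => (swap i j q.1, swap i j q.2))
    (fun q _ => (swap i j q.1, swap i j q.2)) ?_ ?_ ?_ ?_ ?_
  · rintro ⟨a, b⟩ hq
    simp only [Finset.mem_erase, Finset.mem_filter, Finset.mem_univ, true_and] at hq ⊢
    exact (swap_lt_swap h hq.2 hq.1).symm
  · rintro ⟨a, b⟩ hq
    simp only [Finset.mem_erase, Finset.mem_filter, Finset.mem_univ, true_and] at hq ⊢
    exact (swap_lt_swap h hq.2 hq.1).symm
  · intro q _; simp
  · intro q _; simp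
  · intro q _; simp

/-- A function whose product with the factor of two adjacent positions is alternating in them
symmetrizes to zero. -/
theorem hlSymm_eq_zero {ψ : (ℕ → K) → K} {i j : Fin n} (h : (j : ℕ) = i + 1)
    (hψ : ∀ u : Perm (Fin n), ψ (seqOf (x ∘ u)) * hlFactor t (x (u i)) (x (u j)) +
      ψ (seqOf (x ∘ u ∘ swap i j)) * hlFactor t (x (u j)) (x (u i)) = 0) :
    hlSymm t x ψ = 0 := by
  have hij : i < j := by rw [Fin.lt_def]; omega
  refine Finset.sum_involution (fun u _ => u * swap i j) ?_ ?_ (fun _ _ => Finset.mem_univ _) ?_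
  · intro u _
    have e : x ∘ ⇑(u * swap i j) = (x ∘ u) ∘ swap i j := rfl
    rw [e, hlKernel_eq_mul_erase (x ∘ u) hij, hlKernel_eq_mul_erase ((x ∘ u) ∘ swap i j) hij,
      hlKernelErase_comp_swap _ h]
    have := hψ u
    simp only [Function.comp_apply, swap_apply_left, swap_apply_right]
    rw [← mul_assoc, ← mul_assoc, ← add_mul]
    rw [Function.comp_assoc, this, zero_mul]
  · intro u _ _ e
    have := congrArg (fun v => v i) (mul_eq_left.mp e)
    simp at this
    exact hij.ne' this
  · intro u _
    simp [mul_assoc]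

/-- The condition `z ≠ 0` covers the indices beyond the tuple, where the sequence has the default
value `0`. -/
theorem seqOf_ne {z : K} (hz : z ≠ 0) (hx : ∀ i, x i ≠ z) (u : Perm (Fin n)) (i : ℕ) :
    seqOf (x ∘ u) i ≠ z := by
  unfold seqOf
  split_ifs
  · exact hx _
  · exact hz.symm

end Symm

/-! ### Rational functions attached to a partially read row -/

section Branching

variable {K : Type*} [Field K]

/-- The summand in which the new variable `z` takes none of the first `p` parts of `lam`. -/
def keepPart (z t : K) (lam : ℕ → ℕ) (Y : ℕ → K) : ℕ → K
  | 0 => 1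
  | p + 1 => keepPart z t lam Y p * (Y (p + 1) ^ lam p * hlFactor t (Y (p + 1)) z)

/-- The sum of the terms in which the new variable `z` takes one of the first `p` parts of
`lam`. -/
def takePart (z t : K) (lam : ℕ → ℕ) (Y : ℕ → K) : ℕ → K
  | 0 => 0
  | p + 1 => takePart z t lam Y p * (Y p ^ lam p * hlFactor t z (Y p)) +
      keepPart z t lam Y p * z ^ lam p

/-- The contribution of the columns `≥ c` of a row whose edge right of column `c` has spin `-`. -/
def rowMinus (z t : K) (lam : ℕ → ℕ) (c p : ℕ) (Y : ℕ → K) : K :=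
  takePart z t lam Y p / z ^ c

/-- The contribution of the columns `≥ c` of a row whose edge right of column `c` has spin `+`. -/
def rowPlus (z t : K) (lam : ℕ → ℕ) (c p : ℕ) (Y : ℕ → K) : K :=
  keepPart z t lam Y p - (1 - t) * z * (takePart z t lam Y p / z ^ c) * Y p ^ c / (Y p - z)

theorem keepPart_congr {z t : K} {lam : ℕ → ℕ} {Y Y' : ℕ → K} {p : ℕ}
    (h : ∀ i, 1 ≤ i → i ≤ p → Y i = Y' i) : keepPart z t lam Y p = keepPart z t lam Y' p := by
  induction p with
  | zero => rfl
  | succ p ih =>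
    simp only [keepPart, ih fun i h1 h2 => h i h1 (by omega), h (p + 1) (by omega) le_rfl]

/-- One of the `p` parts is taken by `z`, so only `p - 1` variables occur. This is why the monomial
accompanying `rowMinus` starts one index earlier than the one accompanying `rowPlus`. -/
theorem takePart_congr {z t : K} {lam : ℕ → ℕ} {Y Y' : ℕ → K} {p : ℕ}
    (h : ∀ i, 1 ≤ i → i < p → Y i = Y' i) : takePart z t lam Y p = takePart z t lam Y' p := by
  induction p with
  | zero => rfl
  | succ p ih =>
    have hk : keepPart z t lam Y p = keepPart z t lam Y' p :=
      keepPart_congr fun i h1 h2 => h i h1 (by omega)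
    simp only [takePart, hk, ih fun i h1 h2 => h i h1 (by omega)]
    rcases p with _ | p
    · simp [takePart]
    · rw [h (p + 1) (by omega) (by omega)]

variable {z t : K} {lam : ℕ → ℕ} {c p : ℕ} {Y : ℕ → K}

theorem rowMinus_eq_mul (hz : z ≠ 0) :
    rowMinus z t lam c p Y = z * rowMinus z t lam (c + 1) p Y := by
  unfold rowMinus; field_simp; ring

/-- The difference of the two correction terms contains `z - Y p`, which cancels the denominator.
What remains is the term of a vertex `(-, +)`, with its weight `z * (1 - t)`. -/
theorem rowPlus_eq_add (hz : z ≠ 0) (hY : Y p ≠ z) :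
    rowPlus z t lam c p Y =
      rowPlus z t lam (c + 1) p Y + z * (1 - t) * rowMinus z t lam (c + 1) p Y * Y p ^ c := by
  have := sub_ne_zero.mpr hY
  unfold rowMinus rowPlus; field_simp; ring

/-- Splitting the factor as `t + (1 - t) * z / (z - Y p)` turns its second half into exactly the
correction term of `rowPlus`. -/
theorem rowMinus_succ (hz : z ≠ 0) (hY : Y p ≠ z) (hc : lam p = c) :
    rowMinus z t lam c (p + 1) Y =
      rowPlus z t lam c p Y + t * rowMinus z t lam c p Y * Y p ^ c := by
  have h1 := sub_ne_zero.mpr hY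
  have h2 := sub_ne_zero.mpr hY.symm
  simp only [rowMinus, rowPlus, takePart, hc, hlFactor]
  field_simp
  ring

/-- In the part proportional to `keepPart`, the numerators combine as `(Y - t * z) - (1 - t) * z = Y
- z` for `Y = Y (p + 1)`, so its denominator `Y - z` disappears. -/
theorem rowPlus_succ (hz : z ≠ 0) (hY : Y (p + 1) ≠ z) (hc : lam p = c) :
    rowPlus z t lam c (p + 1) Y = (keepPart z t lam Y p - (1 - t) * z *
      (takePart z t lam Y p / z ^ c) * Y p ^ c * hlFactor t z (Y p) / (Y (p + 1) - z)) *
        Y (p + 1) ^ c := by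
  have h1 := sub_ne_zero.mpr hY
  have h2 := sub_ne_zero.mpr hY.symm
  simp only [rowPlus, takePart, keepPart, hc]
  rw [show hlFactor t (Y (p + 1)) z = (Y (p + 1) - t * z) / (Y (p + 1) - z) from rfl]
  field_simp
  ring

end Branching

/-! ### Adding one column to a row -/

section Column

variable {K : Type*} [Field K] {n : ℕ} {z t : K} {x : Fin n → K} {lam : ℕ → ℕ}

theorem seqOf_comp_swap {y : Fin n → K} {i j : Fin n} {k : ℕ} (h1 : 1 ≤ k) (hi : k ≠ i + 1)
    (hj : k ≠ j + 1) : seqOf (y ∘ swap i j) k = seqOf y k := by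
  unfold seqOf
  split_ifs with h
  · rw [Function.comp_apply, swap_apply_of_ne_of_ne] <;> rw [ne_eq, Fin.ext_iff] <;>
      simp only <;> omega
  · rfl

theorem seqOf_succ (y : Fin n → K) (i : Fin n) : seqOf y (i + 1) = y i := by
  simp [seqOf]

theorem rowPlus_succ_symmEq (hz : z ≠ 0) (hx : ∀ i, x i ≠ z) (hinj : Function.Injective x)
    {c p : ℕ} (hp : p + 1 ≤ n) (hc : lam p = c) :
    SymmEq t x (p + 2) (rowPlus z t lam c (p + 1))
      (fun Y => rowPlus z t lam c p Y * Y (p + 1) ^ c) := by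
  rcases p with _ | p
  -- Without earlier parts `takePart` vanishes and the identity is exact; there is no pair of
  -- variables to exchange.
  · refine SymmEq.of_eq fun u => ?_
    rw [rowPlus_succ hz (seqOf_ne hz hx u _) hc]
    simp [rowPlus, takePart]
  intro l
  rw [← sub_eq_zero, ← hlSymm_sub]
  refine hlSymm_eq_zero (i := ⟨p, by omega⟩) (j := ⟨p + 1, by omega⟩) rfl fun u => ?_
  set i : Fin n := ⟨p, by omega⟩
  set j : Fin n := ⟨p + 1, by omega⟩
  -- The difference is symmetric in `y i` and `y j` apart from `y j - t * y i`. Multiplied by the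
  -- kernel factor `(y i - t * y j) / (y i - y j)` it becomes alternating.
  have key : ∀ y : Fin n → K, (∀ k, seqOf y k ≠ z) →
      rowPlus z t lam c (p + 1 + 1) (seqOf y) * listMonomial (seqOf y) (p + 1 + 2) l -
        rowPlus z t lam c (p + 1) (seqOf y) * seqOf y (p + 1 + 1) ^ c *
          listMonomial (seqOf y) (p + 1 + 2) l =
      (1 - t) * z * (takePart z t lam (seqOf y) (p + 1) / z ^ c) * (y i * y j) ^ c *
        listMonomial (seqOf y) (p + 1 + 2) l * (y j - t * y i) /
          ((y i - z) * (y j - z)) := by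
    intro y hy
    rw [rowPlus_succ hz (hy _) hc, rowPlus]
    have hi : seqOf y (p + 1) = y i := seqOf_succ y i
    have hj : seqOf y (p + 1 + 1) = y j := seqOf_succ y j
    have h1 : y i - z ≠ 0 := sub_ne_zero.mpr (hi ▸ hy _)
    have h2 : y j - z ≠ 0 := sub_ne_zero.mpr (hj ▸ hy _)
    have h3 : z - y i ≠ 0 := sub_ne_zero.mpr (hi ▸ hy _).symm
    rw [hi, hj, hlFactor]
    field_simp
    ring
  have e1 : ∀ k, 1 ≤ k → k ≠ p + 1 → k ≠ p + 1 + 1 →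
      seqOf (x ∘ u ∘ swap i j) k = seqOf (x ∘ u) k := fun k h1 h2 h3 =>
    seqOf_comp_swap (y := x ∘ u) h1 h2 h3
  rw [key (x ∘ u) (seqOf_ne hz hx u), key (x ∘ u ∘ swap i j) (seqOf_ne hz hx (u * swap i j)),
    takePart_congr (Y := seqOf (x ∘ u ∘ swap i j)) (Y' := seqOf (x ∘ u))
      fun k h1 h2 => e1 k h1 (by omega) (by omega),
    listMonomial_congr (Y := seqOf (x ∘ u ∘ swap i j)) (Y' := seqOf (x ∘ u))
      fun k h1 => e1 k (by omega) (by omega) (by omega)]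
  simp only [Function.comp_apply, swap_apply_left, swap_apply_right, hlFactor]
  have hne : x (u i) ≠ x (u j) := fun h => by
    have := u.injective (hinj h)
    simp [i, j] at this
  have h1 := sub_ne_zero.mpr hne
  have h2 := sub_ne_zero.mpr hne.symm
  have h3 := sub_ne_zero.mpr (hx (u i))
  have h4 := sub_ne_zero.mpr (hx (u j))
  have h5 : x (u j) - x (u i) = -(x (u i) - x (u j)) := by ring
  rw [h5]
  generalize x (u i) - x (u j) = d at *
  field_simp
  ring

theorem rowPlus_column_symmEq (hz : z ≠ 0) (hx : ∀ i, x i ≠ z) (hinj : Function.Injective x)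
    {c p m : ℕ} (hp : p + m ≤ n) (hc : ∀ i < m, lam (p + i) = c) :
    SymmEq t x (p + m + 1) (rowPlus z t lam c (p + m))
      (fun Y => rowPlus z t lam c p Y * listMonomial Y (p + 1) (List.replicate m c)) := by
  induction m with
  | zero => exact SymmEq.of_eq fun u => by simp [listMonomial]
  | succ m ih =>
    have h := (ih (by omega) fun i hi => hc i (by omega)).mul_pow c
    refine (rowPlus_succ_symmEq (p := p + m) hz hx hinj hp (hc m (by omega))).trans (h.trans ?_)
    refine SymmEq.of_eq fun u => ?_
    rw [listMonomial_replicate_succ, mul_assoc, show p + 1 + m = p + m + 1 by ring]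

theorem qInt_succ (t : K) (m : ℕ) : qInt t (m + 1) = 1 + t * qInt t m := by
  rw [qInt, qInt, Finset.sum_range_succ', Finset.mul_sum]
  simp [pow_succ', add_comm]

/-- Iterating `rowMinus_succ` gives `[m + 1] = 1 + t * [m]` as the recursion of the coefficient. The
truncated exponent count `m - 1` is harmless at `m = 0`, since `qInt t 0 = 0`. -/
theorem rowMinus_column_symmEq (hz : z ≠ 0) (hx : ∀ i, x i ≠ z) (hinj : Function.Injective x)
    {c p m : ℕ} (hp : p + m ≤ n + 1) (hc : ∀ i < m, lam (p + i) = c) :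
    SymmEq t x (p + m) (rowMinus z t lam c (p + m)) (fun Y =>
      qInt t m * (rowPlus z t lam c p Y * listMonomial Y (p + 1) (List.replicate (m - 1) c)) +
        t ^ m * (rowMinus z t lam c p Y * listMonomial Y p (List.replicate m c))) := by
  induction m with
  | zero => exact SymmEq.of_eq fun u => by simp [listMonomial, qInt]
  | succ m ih =>
    have h1 := rowPlus_column_symmEq (t := t) hz hx hinj (p := p) (m := m) (by omega)
      fun i hi => hc i (by omega)
    have h2 := ((ih (by omega) fun i hi => hc i (by omega)).mul_pow c).const_mul t
    refine SymmEq.trans (SymmEq.of_eq fun u => ?_) ((h1.add h2).trans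
      (SymmEq.of_eq fun u => ?_))
    · rw [← add_assoc, rowMinus_succ hz (seqOf_ne hz hx u _) (hc m (by omega)), mul_assoc]
    · simp only [add_tsub_cancel_right]
      rcases m with _ | m
      · simp [listMonomial, qInt]
      · simp only [listMonomial_replicate_succ, add_tsub_cancel_right, qInt_succ,
          show p + 1 + m = p + (m + 1) by ring]
        ring

theorem rowPlus_step (hz : z ≠ 0) (hx : ∀ i, x i ≠ z) (hinj : Function.Injective x)
    {c p m : ℕ} (hp : p + m ≤ n) (hc : ∀ i < m, lam (p + i) = c) :
    SymmEq t x (p + m + 1) (rowPlus z t lam c (p + m)) (fun Y =>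
      rowPlus z t lam (c + 1) p Y * listMonomial Y (p + 1) (List.replicate m c) +
        z * (1 - t) * (rowMinus z t lam (c + 1) p Y *
          listMonomial Y p (List.replicate (m + 1) c))) := by
  refine (rowPlus_column_symmEq hz hx hinj hp hc).trans (SymmEq.of_eq fun u => ?_)
  rw [rowPlus_eq_add hz (seqOf_ne hz hx u _), List.replicate_succ, listMonomial]
  ring

theorem one_sub_mul_qInt {R : Type*} [CommRing R] (t : R) (m : ℕ) : (1 - t) * qInt t m = 1 - t ^ m :=
  mul_neg_geom_sum t m

/-- Expanding `rowPlus` produces a second `rowMinus` term; the two coefficients add up to `z`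
because `(1 - t) * [m] + t ^ m = 1`. -/
theorem rowMinus_step (hz : z ≠ 0) (hx : ∀ i, x i ≠ z) (hinj : Function.Injective x)
    {c p m : ℕ} (hp : p + m ≤ n + 1) (hc : ∀ i < m, lam (p + i) = c) :
    SymmEq t x (p + m) (rowMinus z t lam c (p + m)) (fun Y =>
      qInt t m * (rowPlus z t lam (c + 1) p Y *
        listMonomial Y (p + 1) (List.replicate (m - 1) c)) +
      z * (rowMinus z t lam (c + 1) p Y * listMonomial Y p (List.replicate m c))) := by
  refine (rowMinus_column_symmEq hz hx hinj hp hc).trans (SymmEq.of_eq fun u => ?_)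
  rw [rowPlus_eq_add hz (seqOf_ne hz hx u _), rowMinus_eq_mul (c := c) hz]
  rcases m with _ | m
  · simp [qInt, listMonomial]
  · have := one_sub_mul_qInt t (m + 1)
    simp only [add_tsub_cancel_right, List.replicate_succ, listMonomial]
    linear_combination (z * rowMinus z t lam (c + 1) p (seqOf (x ∘ u)) *
      seqOf (x ∘ u) p ^ c * listMonomial (seqOf (x ∘ u)) (p + 1) (List.replicate m c)) * this

end Column

/-! ### Row transfer sums -/

/-- The parts, in decreasing order, of the partition whose multiplicities are `m`. -/
def word : (N : ℕ) → (Fin N → ℕ) → List ℕ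
  | 0, _ => []
  | N + 1, m => List.replicate (m (Fin.last N)) N ++ word N (Fin.init m)

theorem length_word (N : ℕ) (m : Fin N → ℕ) : (word N m).length = ∑ i, m i := by
  induction N with
  | zero => simp [word]
  | succ N ih => simp [word, ih, Fin.sum_univ_castSucc, Fin.init, add_comm]

/-- The sum, over all admissible configurations of one row with `R`-weights, with spins `m` on the
top edges, `s` on the left edge and `-` on the right edge, of the weight times the value of `F` at
the spins of the bottom edges. -/
def rowSum {K : Type*} [CommRing K] (z t : K) :
    (N : ℕ) → (Fin N → ℕ) → HSpin → ((Fin N → ℕ) → K) → K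
  | 0, _, .plus, _ => 0
  | 0, m, .minus, F => F m
  | N + 1, m, .plus, F =>
      rowSum z t N (Fin.init m) .plus
        (fun k => F (Fin.snoc (α := fun _ => ℕ) k (m (Fin.last N)))) +
      qInt t (m (Fin.last N)) * rowSum z t N (Fin.init m) .minus
        (fun k => F (Fin.snoc (α := fun _ => ℕ) k (m (Fin.last N) - 1)))
  | N + 1, m, .minus, F =>
      z * rowSum z t N (Fin.init m) .minus
        (fun k => F (Fin.snoc (α := fun _ => ℕ) k (m (Fin.last N)))) +
      z * (1 - t) * rowSum z t N (Fin.init m) .plus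
        (fun k => F (Fin.snoc (α := fun _ => ℕ) k (m (Fin.last N) + 1)))

section RowSum

variable {K : Type*} [CommRing K] {z t : K}

theorem rowSum_add (N : ℕ) (m : Fin N → ℕ) (s : HSpin) (F G : (Fin N → ℕ) → K) :
    rowSum z t N m s (fun k => F k + G k) = rowSum z t N m s F + rowSum z t N m s G := by
  induction N generalizing s with
  | zero => cases s <;> simp [rowSum]
  | succ N ih => cases s <;> simp only [rowSum, ih] <;> ring

theorem rowSum_const_mul (N : ℕ) (m : Fin N → ℕ) (s : HSpin) (a : K) (F : (Fin N → ℕ) → K) :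
    rowSum z t N m s (fun k => a * F k) = a * rowSum z t N m s F := by
  induction N generalizing s with
  | zero => cases s <;> simp [rowSum]
  | succ N ih => cases s <;> simp only [rowSum, ih] <;> ring

/-- Reading from the left, the first change from `+` to `-` would occur below a top spin `0`, where
its weight is `qInt t 0 = 0`. -/
theorem rowSum_plus_eq_zero (N : ℕ) (m : Fin N → ℕ) (hm : ∀ i, m i = 0) (F : (Fin N → ℕ) → K) :
    rowSum z t N m .plus F = 0 := by
  induction N with
  | zero => rfl
  | succ N ih => simp [rowSum, hm, qInt, ih (Fin.init m) fun i => hm _]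

/-- Spin is conserved along a row: with right edge `-`, a left edge `+` lowers the total vertical
spin by one and a left edge `-` keeps it. -/
theorem rowSum_congr (N : ℕ) (m : Fin N → ℕ) {F G : (Fin N → ℕ) → K} :
    ((∀ k, ∑ i, k i + 1 = ∑ i, m i → F k = G k) →
      rowSum z t N m .plus F = rowSum z t N m .plus G) ∧
    ((∀ k, ∑ i, k i = ∑ i, m i → F k = G k) →
      rowSum z t N m .minus F = rowSum z t N m .minus G) := by
  induction N with
  | zero => exact ⟨fun _ => rfl, fun h => h m rfl⟩
  | succ N ih =>
    have hs : ∑ i, m i = ∑ i, Fin.init m i + m (Fin.last N) := by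
      rw [Fin.sum_univ_castSucc]; rfl
    have hk : ∀ (k : Fin N → ℕ) (a : ℕ),
        ∑ i, (Fin.snoc k a : Fin (N + 1) → ℕ) i = ∑ i, k i + a := fun k a => by
      simp [Fin.sum_univ_castSucc]
    refine ⟨fun h => ?_, fun h => ?_⟩
    · simp only [rowSum]
      congr 1
      · exact (ih _).1 fun k e => h _ (by rw [hk, hs]; omega)
      · rcases Nat.eq_zero_or_pos (m (Fin.last N)) with h0 | h0
        · simp [h0, qInt]
        · rw [(ih _).2 fun k e => h _ (by rw [hk, hs]; omega)]
    · simp only [rowSum]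
      congr 2
      · exact (ih _).2 fun k e => h _ (by rw [hk, hs]; omega)
      · exact (ih _).1 fun k e => h _ (by rw [hk, hs]; omega)

end RowSum

/-! ### The branching rule, column by column -/

section BranchingRule

variable {K : Type*} [Field K] {n : ℕ} {z t : K} {x : Fin n → K}

theorem word_snoc (N : ℕ) (k : Fin N → ℕ) (a : ℕ) :
    word (N + 1) (Fin.snoc k a) = List.replicate a N ++ word N k := by
  simp [word]

/-- The left side is an invariant of the reading process: the first `p` parts lie in columns already
read, and the two terms are the possible spins at the cut. At `N = 0` only the spin `-` survives,
leaving `takePart` itself. -/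
theorem rowSum_add_rowSum_eq (hz : z ≠ 0) (hx : ∀ i, x i ≠ z) (hinj : Function.Injective x)
    (lam : ℕ → ℕ) (N : ℕ) (m : Fin N → ℕ) (p : ℕ) (hp : p + ∑ i, m i = n + 1)
    (hlam : ∀ i (h : i < (word N m).length), lam (p + i) = (word N m)[i]) :
    rowSum z t N m .plus (fun k => hlSymm t x fun Y =>
        rowPlus z t lam N p Y * listMonomial Y (p + 1) (word N k)) +
      rowSum z t N m .minus (fun k => hlSymm t x fun Y =>
        rowMinus z t lam N p Y * listMonomial Y p (word N k)) =
      hlSymm t x fun Y => takePart z t lam Y (n + 1) := by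
  induction N generalizing p with
  | zero =>
    have : p = n + 1 := by simpa using hp
    subst this
    simp [rowSum, word, listMonomial, rowMinus]
  | succ N ih =>
    have hs : ∑ i, m i = ∑ i, Fin.init m i + m (Fin.last N) := by
      rw [Fin.sum_univ_castSucc]; rfl
    generalize ha : m (Fin.last N) = a at hs
    have hc : ∀ i < a, lam (p + i) = N := fun i hi => by
      rw [hlam i (by simp [word, ha]; omega)]
      simp [word, ha, List.getElem_append_left, hi]
    have IH := ih (Fin.init m) (p + a) (by omega) fun i hi => by
      rw [add_assoc, hlam (a + i) (by simp [word, ha]; omega)]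
      simp [word, ha, List.getElem_append_right]
    have hminus := rowMinus_step (t := t) hz hx hinj (c := N) (p := p) (m := a) (by omega) hc
    rw [← IH]
    have e1 : rowSum z t N (Fin.init m) .minus (fun k => hlSymm t x fun Y =>
          rowMinus z t lam N (p + a) Y * listMonomial Y (p + a) (word N k)) =
        qInt t a * rowSum z t N (Fin.init m) .minus (fun k => hlSymm t x fun Y =>
          rowPlus z t lam (N + 1) p Y *
            listMonomial Y (p + 1) (List.replicate (a - 1) N ++ word N k)) +
        z * rowSum z t N (Fin.init m) .minus (fun k => hlSymm t x fun Y =>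
          rowMinus z t lam (N + 1) p Y *
            listMonomial Y p (List.replicate a N ++ word N k)) := by
      rw [← rowSum_const_mul, ← rowSum_const_mul, ← rowSum_add]
      congr 1
      funext k
      rw [hminus, ← hlSymm_const_mul, ← hlSymm_const_mul, ← hlSymm_add]
      refine hlSymm_congr fun u => ?_
      rcases a with _ | a
      · simp [qInt, listMonomial, mul_assoc]
      · simp only [listMonomial_append, List.length_replicate, add_tsub_cancel_right,
          show p + 1 + a = p + (a + 1) by ring]
        ring
    have e2 : rowSum z t N (Fin.init m) .plus (fun k => hlSymm t x fun Y =>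
          rowPlus z t lam N (p + a) Y * listMonomial Y (p + a + 1) (word N k)) =
        rowSum z t N (Fin.init m) .plus (fun k => hlSymm t x fun Y =>
          rowPlus z t lam (N + 1) p Y *
            listMonomial Y (p + 1) (List.replicate a N ++ word N k)) +
        z * (1 - t) * rowSum z t N (Fin.init m) .plus (fun k => hlSymm t x fun Y =>
          rowMinus z t lam (N + 1) p Y *
            listMonomial Y p (List.replicate (a + 1) N ++ word N k)) := by
      -- If all `n + 1` parts have been read, `rowPlus_step` would need a nonexistent variable, but
      -- the remaining columns are empty and the `+` sums vanish.
      rcases Nat.lt_or_ge n (p + a) with hn | hn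
      · have h0 : ∀ i, Fin.init m i = 0 := fun i => by
          have h1 := Finset.single_le_sum (f := Fin.init m) (fun _ _ => Nat.zero_le _)
            (Finset.mem_univ i)
          omega
        simp only [rowSum_plus_eq_zero N _ h0, mul_zero, add_zero]
      · rw [← rowSum_const_mul, ← rowSum_add]
        congr 1
        funext k
        rw [rowPlus_step hz hx hinj hn hc, ← hlSymm_const_mul, ← hlSymm_add]
        refine hlSymm_congr fun u => ?_
        simp only [listMonomial_append, List.length_replicate,
          show p + 1 + a = p + a + 1 by ring, show p + (a + 1) = p + a + 1 by ring]
        ring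
    rw [e1, e2]
    simp only [rowSum, word_snoc, ha]
    ring

theorem takePart_succ_eq_sum (lam : ℕ → ℕ) (Y : ℕ → K) (p : ℕ) :
    takePart z t lam Y (p + 1) = ∑ k ∈ Finset.range (p + 1), z ^ lam k *
      ∏ i ∈ Finset.range p, if i < k then Y (i + 1) ^ lam i * hlFactor t (Y (i + 1)) z
        else Y (i + 1) ^ lam (i + 1) * hlFactor t z (Y (i + 1)) := by
  have hkeep : ∀ p, keepPart z t lam Y p =
      ∏ i ∈ Finset.range p, Y (i + 1) ^ lam i * hlFactor t (Y (i + 1)) z := by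
    intro p
    induction p with
    | zero => rfl
    | succ p ih => rw [keepPart, ih, Finset.prod_range_succ]
  induction p with
  | zero => simp [takePart, keepPart]
  | succ p ih =>
    rw [takePart, ih, Finset.sum_range_succ _ (p + 1), hkeep, mul_comm _ (z ^ _), Finset.sum_mul]
    congr 1
    · refine Finset.sum_congr rfl fun k hk => ?_
      have hk' : ¬ p < k := by have := Finset.mem_range.mp hk; omega
      rw [Finset.prod_range_succ, if_neg hk', mul_assoc]
    · congr 1
      exact Finset.prod_congr rfl fun i hi => (if_pos (Finset.mem_range.mp hi)).symm

end BranchingRule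

/-! ### Splitting the symmetric group by the position of the new variable -/

/-- The permutation of `Fin (n + 1)` that takes the value `0` at `k` and is given by `u` on the
remaining positions. -/
def insertPerm {n : ℕ} (k : Fin (n + 1)) (u : Perm (Fin n)) : Perm (Fin (n + 1)) :=
  (finSuccEquiv' k).trans ((optionCongr u).trans (finSuccEquiv' 0).symm)

theorem insertPerm_self {n : ℕ} (k : Fin (n + 1)) (u : Perm (Fin n)) : insertPerm k u k = 0 := by
  simp [insertPerm]

theorem insertPerm_succAbove {n : ℕ} (k : Fin (n + 1)) (u : Perm (Fin n)) (i : Fin n) :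
    insertPerm k u (k.succAbove i) = (u i).succ := by
  simp [insertPerm]

theorem insertPerm_bijective (n : ℕ) :
    Function.Bijective fun q : Fin (n + 1) × Perm (Fin n) => insertPerm q.1 q.2 := by
  rw [Fintype.bijective_iff_injective_and_card]
  constructor
  · rintro ⟨k, u⟩ ⟨k', u'⟩ h
    simp only at h
    have hk : k = k' := by
      apply (insertPerm k u).injective
      rw [insertPerm_self, h, insertPerm_self]
    subst hk
    refine Prod.ext rfl (Equiv.ext fun i => ?_)
    have := congrArg (fun w => w (k.succAbove i)) h
    simpa [insertPerm_succAbove] using this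
  · simp [Fintype.card_perm, Nat.factorial_succ]

section Recursion

variable {K : Type*} [Field K] {n : ℕ} {z t : K} {x : Fin n → K}

theorem hlKernel_eq_ite (y : Fin n → K) :
    hlKernel t y = ∏ i, ∏ j, if i < j then hlFactor t (y i) (y j) else 1 := by
  refine Finset.prod_congr rfl fun i _ => ?_
  rw [← Finset.prod_filter]
  refine Finset.prod_congr ?_ fun _ _ => rfl
  ext j; simp

/-- The variable `z` sits at position `k`, so the variables before it contribute factors with `z`
second, and those after it factors with `z` first. -/
theorem hlKernel_cons_insertPerm (k : Fin (n + 1)) (u : Perm (Fin n)) :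
    hlKernel t ((Fin.cons z x : Fin (n + 1) → K) ∘ insertPerm k u) =
      (∏ i : Fin n, if (i : ℕ) < k then hlFactor t (x (u i)) z else hlFactor t z (x (u i))) *
        hlKernel t (x ∘ u) := by
  rw [hlKernel_eq_ite, hlKernel_eq_ite, Fin.prod_univ_succAbove _ k,
    Fin.prod_univ_succAbove _ k]
  simp only [Fin.prod_univ_succAbove _ k, Finset.prod_mul_distrib, Function.comp_apply,
    insertPerm_self, insertPerm_succAbove, Fin.cons_zero, Fin.cons_succ, lt_self_iff_false,
    if_false, one_mul, Fin.succAbove_lt_succAbove_iff, ← mul_assoc]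
  congr 1
  rw [← Finset.prod_mul_distrib]
  refine Finset.prod_congr rfl fun i _ => ?_
  have h1 : k < k.succAbove i ↔ ¬ (i : ℕ) < k := by
    rw [Fin.lt_succAbove_iff_le_castSucc, Fin.le_def, Fin.val_castSucc, not_lt]
  have h2 : k.succAbove i < k ↔ (i : ℕ) < k := by
    rw [Fin.succAbove_lt_iff_castSucc_lt, Fin.lt_def, Fin.val_castSucc]
  simp only [h1, h2]
  split_ifs <;> simp

/-- The sum defining the Hall–Littlewood function, split by the part that the first variable
takes. -/
theorem hallLittlewoodSum_cons (lam : ℕ → ℕ) :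
    hallLittlewoodSum (fun i : Fin (n + 1) => lam i) (Fin.cons z x : Fin (n + 1) → K) t =
      hlSymm t x fun Y => takePart z t lam Y (n + 1) := by
  have h : hallLittlewoodSum (fun i : Fin (n + 1) => lam i) (Fin.cons z x : Fin (n + 1) → K) t =
      ∑ w : Perm (Fin (n + 1)), (∏ i, (Fin.cons z x : Fin (n + 1) → K) (w i) ^ lam i) *
        hlKernel t ((Fin.cons z x : Fin (n + 1) → K) ∘ w) := rfl
  rw [h, ← (insertPerm_bijective n).sum_comp, Fintype.sum_prod_type_right, hlSymm]
  refine Finset.sum_congr rfl fun u _ => ?_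
  rw [takePart_succ_eq_sum, Finset.sum_mul, ← Fin.sum_univ_eq_sum_range (fun k =>
    z ^ lam k * (∏ i ∈ Finset.range n, if i < k then _ else _) * _)]
  refine Finset.sum_congr rfl fun k _ => ?_
  rw [hlKernel_cons_insertPerm, Fin.prod_univ_succAbove _ k, ← mul_assoc]
  congr 1
  rw [insertPerm_self, Fin.cons_zero, mul_assoc, ← Finset.prod_mul_distrib,
    ← Fin.prod_univ_eq_prod_range (fun i => if i < (k : ℕ) then _ else _)]
  congr 1
  refine Finset.prod_congr rfl fun i _ => ?_
  rw [insertPerm_succAbove, Fin.cons_succ, seqOf_succ]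
  by_cases hi : (i : ℕ) < k
  · simp [hi, Fin.succAbove_of_castSucc_lt k i (by simpa [Fin.lt_def] using hi)]
  · simp [hi, Fin.succAbove_of_le_castSucc k i (by simpa [Fin.le_def] using hi)]

theorem hallLittlewoodSum_eq_hlSymm (l : List ℕ) (hl : l.length = n) :
    hallLittlewoodSum (fun i : Fin n => l.getD i 0) x t =
      hlSymm t x fun Y => listMonomial Y 1 l := by
  have h : ∀ (Y : ℕ → K) (k : ℕ) (l : List ℕ),
      listMonomial Y k l = ∏ i ∈ Finset.range l.length, Y (k + i) ^ l.getD i 0 := by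
    intro Y k l
    induction l generalizing k with
    | nil => simp [listMonomial]
    | cons c l ih =>
      rw [listMonomial, ih, List.length_cons, Finset.prod_range_succ', mul_comm]
      simp only [List.getD_cons_succ, List.getD_cons_zero, add_zero, add_right_comm k 1,
        ← add_assoc]
  refine Finset.sum_congr rfl fun u _ => ?_
  beta_reduce
  rw [h, hl, ← Fin.prod_univ_eq_prod_range (fun i => seqOf (x ∘ u) (1 + i) ^ l.getD i 0)]
  simp only [add_comm 1, seqOf_succ, Function.comp_apply]
  rfl

/-- The branching rule for Hall–Littlewood functions. -/
theorem hallLittlewoodSum_branching (hz : z ≠ 0) (hx : ∀ i, x i ≠ z)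
    (hinj : Function.Injective x) (N : ℕ) (m : Fin N → ℕ) (hm : ∑ i, m i = n + 1) :
    rowSum z t N m .plus (fun k => hallLittlewoodSum (fun i : Fin n => (word N k).getD i 0) x t) =
      hallLittlewoodSum (fun i : Fin (n + 1) => (word N m).getD i 0)
        (Fin.cons z x : Fin (n + 1) → K) t := by
  rw [hallLittlewoodSum_cons fun i => (word N m).getD i 0, ← rowSum_add_rowSum_eq hz hx hinj _ N m
    0 (by omega) fun i h => by rw [zero_add, List.getD_eq_getElem _ _ h]]
  have h0 : ∀ (N : ℕ) (m : Fin N → ℕ), rowSum z t N m .minus (fun _ => (0 : K)) = 0 := fun N m => by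
    simpa using rowSum_const_mul (z := z) (t := t) N m .minus 0 (fun _ => 0)
  -- At `p = 0` nothing has been read: `rowPlus` is `1` and `rowMinus` is `0`, which matches the
  -- left boundary spin `+`.
  simp only [rowPlus, rowMinus, takePart, keepPart]
  simp only [zero_div, mul_zero, zero_mul, sub_zero, one_mul, zero_add]
  rw [show hlSymm t x (fun _ => 0) = 0 by simp [hlSymm], h0, add_zero]
  exact (rowSum_congr N m).1 fun k hk => hallLittlewoodSum_eq_hlSymm _ (by rw [length_word]; omega)

end Recursion

/-! ### From states to iterated row sums -/

/-- The spin of the bottom edge of an admissible vertex, given its other three spins. -/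
def bottomSpin (left : HSpin) (top : ℕ) (right : HSpin) : ℕ :=
  match left, right with
  | .plus, .plus => top
  | .minus, .minus => top
  | .minus, .plus => top + 1
  | .plus, .minus => top - 1

/-- The `R`-weight of the vertex whose bottom edge has the spin `bottomSpin left top right`. -/
def vertexR {K : Type*} [CommRing K] (t z : K) (left : HSpin) (top : ℕ) (right : HSpin) : K :=
  match left, right with
  | .plus, .plus => 1
  | .minus, .minus => z
  | .minus, .plus => z * (1 - t)
  | .plus, .minus => qInt t top

/-- The spins on the bottom edges of a row. -/
def rowBottom {M : ℕ} (m : Fin M → ℕ) (y : Fin (M + 1) → HSpin) (j : Fin M) : ℕ :=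
  bottomSpin (y j.succ) (m j) (y j.castSucc)

/-- The weight of a row with spin `s` on the left edge. -/
def rowWeight {K : Type*} [CommRing K] {M : ℕ} (t z : K) (s : HSpin) (m : Fin M → ℕ)
    (y : Fin (M + 1) → HSpin) : K :=
  if y (Fin.last M) = s ∧ y 0 = .minus then ∏ j, vertexR t z (y j.succ) (m j) (y j.castSucc) else 0

/-- The spins on all vertical edges, computed from the horizontal spins and the top spins. -/
def colSpins {M : ℕ} : (r : ℕ) → (Fin M → ℕ) → (Fin r → Fin (M + 1) → HSpin) →
    Fin (r + 1) → Fin M → ℕ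
  | 0, m, _ => fun _ => m
  | r + 1, m, h => Fin.cons m (colSpins r (rowBottom m (h 0)) (Fin.tail h))

/-- The weight of the only possibly admissible state with given top spins and horizontal spins. -/
def gridWeight {K : Type*} [CommRing K] {M : ℕ} (t : K) (r : ℕ) (z : Fin r → K) (m : Fin M → ℕ)
    (h : Fin r → Fin (M + 1) → HSpin) : K :=
  (∏ i, rowWeight t (z i) .plus (colSpins r m h i.castSucc) (h i)) *
    if colSpins r m h (Fin.last r) = 0 then 1 else 0

section

variable {K : Type*} [CommRing K] {M : ℕ}

theorem weightR_eq (t z : K) (l : HSpin) (m : ℕ) (r : HSpin) (k : ℕ) :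
    weightR t z l m r k = if k = bottomSpin l m r then vertexR t z l m r else 0 := by
  have h : (if m = k + 1 then qInt t (k + 1) else 0) = if k = m - 1 then qInt t m else 0 := by
    -- For top spin `0` the truncated value `m - 1 = 0` does not describe an admissible vertex, but
    -- its assigned weight `qInt t 0` vanishes.
    rcases m with _ | m
    · simp [qInt]
    · simp only [Nat.add_right_cancel_iff, add_tsub_cancel_right, eq_comm (a := m)]
      split_ifs with h
      · rw [h]
      · rfl
  cases l <;> cases r
  · rfl
  · exact h
  · rfl
  · rfl

theorem sum_hspin (f : HSpin → K) : ∑ s, f s = f .plus + f .minus := by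
  rw [show (Finset.univ : Finset HSpin) = {.plus, .minus} from rfl, Finset.sum_pair (by decide)]

theorem rowSum_eq_sum (t z : K) (s : HSpin) (m : Fin M → ℕ) (F : (Fin M → ℕ) → K) :
    rowSum z t M m s F = ∑ y, rowWeight t z s m y * F (rowBottom m y) := by
  induction M generalizing s with
  | zero =>
    rw [← (Equiv.funUnique (Fin 1) HSpin).symm.sum_comp, sum_hspin]
    have hF : ∀ y, F (rowBottom m y) = F m := fun y => congrArg F (Subsingleton.elim _ _)
    simp only [hF]
    cases s <;> simp [rowSum, rowWeight]
  | succ M ih =>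
    have e : ∑ y, rowWeight t z s m y * F (rowBottom m y) =
        ∑ y : Fin (M + 1) → HSpin, ∑ s' : HSpin, vertexR t z s (m (Fin.last M)) s' *
          (rowWeight t z s' (Fin.init m) y * F (Fin.snoc (α := fun _ => ℕ)
            (rowBottom (Fin.init m) y) (bottomSpin s (m (Fin.last M)) s'))) := by
      rw [← (Fin.snocEquiv fun _ : Fin (M + 2) => HSpin).sum_comp, Fintype.sum_prod_type_right]
      refine Finset.sum_congr rfl fun y _ => ?_
      have hb : rowBottom m (Fin.snoc (α := fun _ => HSpin) y s) = Fin.snoc (α := fun _ => ℕ)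
          (rowBottom (Fin.init m) y) (bottomSpin s (m (Fin.last M)) (y (Fin.last M))) := by
        funext j
        refine Fin.lastCases ?_ (fun j => ?_) j
        · simp [rowBottom]
        · simp only [rowBottom, Fin.snoc_castSucc, Fin.succ_castSucc, Fin.init]
      have h0 : (Fin.snoc (α := fun _ => HSpin) y s : Fin (M + 2) → HSpin) 0 = y 0 :=
        Fin.snoc_castSucc (α := fun _ => HSpin) _ _ 0
      rw [Finset.sum_eq_single s, Finset.sum_eq_single (y (Fin.last M))]
      · change rowWeight t z s m (Fin.snoc (α := fun _ => HSpin) y s) *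
          F (rowBottom m (Fin.snoc (α := fun _ => HSpin) y s)) = _
        rw [hb, ← mul_assoc]
        congr 1
        simp only [rowWeight, Fin.snoc_last, h0, true_and, Fin.prod_univ_castSucc, Fin.succ_castSucc,
          Fin.snoc_castSucc, Fin.succ_last, Fin.init]
        split_ifs
        · ring
        · simp
      · intro s' _ hs'
        simp [rowWeight, hs'.symm]
      · simp
      · intro s' _ hs'
        simp [rowWeight, hs']
      · simp
    rw [e, Finset.sum_comm]
    simp only [← Finset.mul_sum]
    rw [sum_hspin]
    cases s
    · simp [rowSum, vertexR, bottomSpin, ih]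
    · simp [rowSum, vertexR, bottomSpin, ih, add_comm]

theorem colSpins_zero (r : ℕ) (m : Fin M → ℕ) (h : Fin r → Fin (M + 1) → HSpin) :
    colSpins r m h 0 = m := by
  cases r <;> rfl

theorem colSpins_succ (r : ℕ) (m : Fin M → ℕ) (h : Fin r → Fin (M + 1) → HSpin) (i : Fin r) :
    colSpins r m h i.succ = rowBottom (colSpins r m h i.castSucc) (h i) := by
  induction r generalizing m with
  | zero => exact i.elim0
  | succ r ih =>
    refine Fin.cases ?_ (fun i => ?_) i
    · simp [colSpins, colSpins_zero]
    · simp only [colSpins, Fin.cons_succ, ih, Fin.castSucc_succ]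
      rfl

theorem sum_gridWeight_succ (t : K) (r : ℕ) (z : Fin (r + 1) → K) (m : Fin M → ℕ) :
    ∑ h, gridWeight t (r + 1) z m h =
      rowSum (z 0) t M m .plus fun k => ∑ h, gridWeight t r (Fin.tail z) k h := by
  rw [rowSum_eq_sum, ← (Fin.consEquiv fun _ : Fin (r + 1) => Fin (M + 1) → HSpin).sum_comp,
    Fintype.sum_prod_type]
  refine Finset.sum_congr rfl fun y _ => ?_
  rw [Finset.mul_sum]
  refine Finset.sum_congr rfl fun h _ => ?_
  simp only [gridWeight, Fin.prod_univ_succ, Fin.consEquiv_apply, colSpins, Fin.cons_zero,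
    Fin.cons_succ, Fin.castSucc_zero, ← Fin.succ_castSucc, ← Fin.succ_last,
    mul_assoc]
  rfl

/-- In a state of nonzero weight the vertical spins are forced, row by row from the top, by the
horizontal ones. The infinite set of states thus reduces to finitely many horizontal configurations.
-/
theorem ZR_eq_sum_gridWeight {r N : ℕ} (lam : Fin r → ℕ) (z : Fin r → K) (t : K) :
    ZR N lam z t = ∑ h, gridWeight t r z (fun j : Fin (N + 1) => mult lam j) h := by
  classical
  have hvert : ∀ s : State r N lam, s.weight (weightR t) z ≠ 0 → ∀ i j,
      s.v i.succ j = bottomSpin (s.h i j.succ) (s.v i.castSucc j) (s.h i j.castSucc) := by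
    intro s hs i j
    by_contra hne
    refine hs (Finset.prod_eq_zero (Finset.mem_univ i)
      (Finset.prod_eq_zero (Finset.mem_univ j) ?_))
    rw [weightR_eq, if_neg hne]
  have hv : ∀ s : State r N lam, s.weight (weightR t) z ≠ 0 →
      s.v = colSpins r (fun j : Fin (N + 1) => mult lam j) s.h := by
    intro s hs
    funext i
    induction i using Fin.induction with
    | zero => rw [colSpins_zero]; exact funext s.top_boundary
    | succ i ih =>
      rw [colSpins_succ, ← ih]
      exact funext fun j => hvert s hs i j
  have hw : ∀ s : State r N lam, s.v = colSpins r (fun j : Fin (N + 1) => mult lam j) s.h →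
      s.weight (weightR t) z = gridWeight t r z (fun j : Fin (N + 1) => mult lam j) s.h := by
    intro s hs
    have hlast : colSpins r (fun j : Fin (N + 1) => mult lam j) s.h (Fin.last r) = 0 := by
      rw [← hs]; exact funext s.bottom_boundary
    rw [gridWeight, if_pos hlast, mul_one]
    refine Finset.prod_congr rfl fun i _ => ?_
    rw [rowWeight, if_pos ⟨s.left_boundary i, s.right_boundary i⟩]
    refine Finset.prod_congr rfl fun j _ => ?_
    rw [weightR_eq, hs, if_pos (by rw [colSpins_succ]; rfl)]
  rw [ZR, partitionFunction, finsum_eq_sum _ (finite_support_weightR z t)]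
  refine Finset.sum_bij_ne_zero (fun s _ _ => s.h) (fun _ _ _ => Finset.mem_univ _) ?_ ?_ ?_
  · intro s _ hs s' _ hs' e
    refine State.ext e ?_
    rw [hv s hs, hv s' hs', e]
  · intro h _ hh
    have hlast : colSpins r (fun j : Fin (N + 1) => mult lam j) h (Fin.last r) = 0 := by
      by_contra hne
      exact hh (by rw [gridWeight, if_neg hne, mul_zero])
    have hb : ∀ i, h i (Fin.last (N + 1)) = .plus ∧ h i 0 = .minus := by
      intro i
      by_contra hne
      refine hh ?_
      rw [gridWeight, Finset.prod_eq_zero (Finset.mem_univ i) (if_neg hne), zero_mul]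
    let s : State r N lam :=
      { h := h
        v := colSpins r (fun j : Fin (N + 1) => mult lam j) h
        left_boundary := fun i => (hb i).1
        right_boundary := fun i => (hb i).2
        top_boundary := fun j => by rw [colSpins_zero]
        bottom_boundary := fun j => by rw [hlast]; rfl }
    have hs : s.weight (weightR t) z ≠ 0 := by rw [hw s rfl]; exact hh
    exact ⟨s, by simpa using hs, hs, rfl⟩
  · intro s _ hs
    exact hw s (hv s hs)

end

theorem sum_gridWeight_eq_hallLittlewoodSum {K : Type*} [Field K] {M r : ℕ} (t : K) (z : Fin r → K)
    (hz : ∀ i, z i ≠ 0) (hinj : Function.Injective z) (m : Fin M → ℕ) (hm : ∑ i, m i = r) :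
    ∑ h, gridWeight t r z m h =
      hallLittlewoodSum (fun i : Fin r => (word M m).getD i 0) z t := by
  induction r generalizing m with
  | zero =>
    have h0 : m = 0 := by
      funext i
      simpa using (Finset.sum_eq_zero_iff.mp hm) i
    simp [gridWeight, colSpins, hallLittlewoodSum, h0]
  | succ r ih =>
    rw [sum_gridWeight_succ, (rowSum_congr M m).1 fun k hk => ih (Fin.tail z) (fun i => hz _)
      (fun i j e => Fin.succ_injective _ (hinj e)) k (by omega),
      hallLittlewoodSum_branching (x := Fin.tail z) (hz 0) (fun i e => Fin.succ_ne_zero i (hinj e))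
      (fun i j e => Fin.succ_injective _ (hinj e)) M m hm, Fin.cons_self_tail]

/-! ### Recovering the partition from its multiplicities -/

theorem count_word (M : ℕ) (m : Fin M → ℕ) (j : ℕ) :
    (word M m).count j = if h : j < M then m ⟨j, h⟩ else 0 := by
  induction M with
  | zero => simp [word]
  | succ M ih =>
    rw [word, List.count_append, ih, List.count_replicate]
    rcases lt_trichotomy j M with h | h | h
    · simp [h, h.ne', Nat.lt_succ_of_lt h, Fin.init]
    · subst h; simp [Fin.last]
    · simp [h.ne, Nat.not_lt.mpr h.le, Nat.not_lt.mpr (Nat.succ_le_of_lt h)]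

theorem lt_of_mem_word {M : ℕ} {m : Fin M → ℕ} {j : ℕ} (h : j ∈ word M m) : j < M := by
  by_contra hj
  have := List.count_pos_iff.mpr h
  rw [count_word, dif_neg hj] at this
  exact lt_irrefl _ this

theorem pairwise_word (M : ℕ) (m : Fin M → ℕ) : (word M m).Pairwise (· ≥ ·) := by
  induction M with
  | zero => simp [word]
  | succ M ih =>
    rw [word, List.pairwise_append]
    refine ⟨List.pairwise_replicate.mpr (Or.inr le_rfl), ih _, fun a ha b hb => ?_⟩
    rw [List.eq_of_mem_replicate ha]
    exact (lt_of_mem_word hb).le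

/-- Both lists are weakly decreasing and contain every number equally often. -/
theorem word_mult {r N : ℕ} {lam : Fin r → ℕ} (hlam : Antitone lam) (hN : ∀ i, lam i ≤ N) :
    word (N + 1) (fun j => mult lam j) = List.ofFn lam := by
  refine List.Perm.eq_of_pairwise (le := (· ≥ ·)) (fun a b _ _ h1 h2 => le_antisymm h2 h1)
    (pairwise_word _ _) ?_ ?_
  · rw [List.pairwise_ofFn]
    exact fun i j h => hlam h.le
  · rw [List.perm_iff_count]
    intro j
    have hc : (List.ofFn lam).count j = mult lam j := by
      rw [List.ofFn_eq_map, mult, List.count, List.countP_map]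
      rw [Finset.card_def, Finset.filter_val, ← Multiset.countP_eq_card_filter]
      rw [show (Finset.univ : Finset (Fin r)).val = (List.finRange r : Multiset (Fin r)) from rfl,
        Multiset.coe_countP]
      congr 1
    rw [count_word, hc]
    split_ifs with h
    · rfl
    · symm
      rw [mult, Finset.card_eq_zero, Finset.filter_eq_empty_iff]
      intro i _ e
      have := hN i
      omega

theorem ZR_eq_hallLittlewoodSum {K : Type*} [Field K] {r N : ℕ} {lam : Fin r → ℕ}
    (hlam : Antitone lam) (hN : ∀ i, lam i ≤ N) (z : Fin r → K) (t : K) (hz : ∀ i, z i ≠ 0)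
    (hinj : Function.Injective z) : ZR N lam z t = hallLittlewoodSum lam z t := by
  rw [ZR_eq_sum_gridWeight, sum_gridWeight_eq_hallLittlewoodSum t z hz hinj]
  · congr 1
    funext i
    rw [word_mult hlam hN, List.getD_eq_getElem _ _ (by simp), List.getElem_ofFn]
  · rw [← length_word, word_mult hlam hN, List.length_ofFn]

/-! ### Comparing the two systems of weights -/

/-- The polynomial `[n]! = ∏_{i = 1}^n (1 - t^i) / (1 - t)`. -/
def qFactorial {K : Type*} [CommRing K] (t : K) (n : ℕ) : K :=
  ∏ i ∈ Finset.range n, qInt t (i + 1)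

/-- A gauge change: attaching `[n]!` to a vertical edge of spin `n` turns one system of weights into
the other. -/
theorem weightR_mul_qFactorial {K : Type*} [CommRing K] (t z : K) (l : HSpin) (m : ℕ) (r : HSpin)
    (k : ℕ) : weightR t z l m r k * qFactorial t k = weightP t z l m r k * qFactorial t m := by
  cases l <;> cases r <;> simp only [weightR, weightP] <;> split_ifs with h <;>
    try simp only [zero_mul, one_mul]
  · rw [h]
  · rw [h, qFactorial, qFactorial, Finset.prod_range_succ, mul_comm]
  · rw [h, qFactorial, qFactorial, Finset.prod_range_succ, ← one_sub_mul_qInt]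
    ring
  · rw [h]

theorem vNum_eq_qFactorial {K : Type*} [Field K] {t : K} (ht : t ≠ 1) (m : ℕ) :
    vNum t m = qFactorial t m := by
  simp only [vNum, qFactorial, qInt_eq_div ht]
  rw [Finset.range_eq_Ico, Finset.prod_Ico_add' (fun i => (1 - t ^ i) / (1 - t)) 0 m 1]
  rfl

theorem State.weightR_eq_mul_weightP {K : Type*} [Field K] {r N : ℕ} {lam : Fin r → ℕ}
    (z : Fin r → K) {t : K} (ht : ∀ n, qFactorial t n ≠ 0) (s : State r N lam) :
    s.weight (weightR t) z =
      (∏ j : Fin (N + 1), qFactorial t (mult lam j)) * s.weight (weightP t) z := by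
  have h : s.weight (weightR t) z * ∏ i : Fin r, ∏ j, qFactorial t (s.v i.succ j) =
      s.weight (weightP t) z * ∏ i : Fin r, ∏ j, qFactorial t (s.v i.castSucc j) := by
    simp only [State.weight, ← Finset.prod_mul_distrib, weightR_mul_qFactorial]
  have h' : ∏ i : Fin r, ∏ j, qFactorial t (s.v i.castSucc j) =
      (∏ j : Fin (N + 1), qFactorial t (mult lam j)) *
        ∏ i : Fin r, ∏ j, qFactorial t (s.v i.succ j) := by
    -- The product over all levels of vertical edges is split at the bottom and at the top. The
    -- bottom spins contribute `[0]! = 1`, the top spins the factorials of the multiplicities.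
    have e := Fin.prod_univ_castSucc fun i => ∏ j, qFactorial t (s.v i j)
    rw [Fin.prod_univ_succ] at e
    simpa [s.top_boundary, s.bottom_boundary, qFactorial] using e.symm
  have hne : ∏ i : Fin r, ∏ j, qFactorial t (s.v i.succ j) ≠ 0 :=
    Finset.prod_ne_zero_iff.mpr fun _ _ => Finset.prod_ne_zero_iff.mpr fun _ _ => ht _
  rw [h'] at h
  refine mul_right_cancel₀ hne (h.trans ?_)
  ring

theorem vLam_eq_prod {K : Type*} [Field K] {r N : ℕ} {lam : Fin r → ℕ} (hN : ∀ i, lam i ≤ N)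
    {t : K} (ht : t ≠ 1) : vLam lam t = ∏ j : Fin (N + 1), qFactorial t (mult lam j) := by
  rw [Fin.prod_univ_eq_prod_range (fun j => qFactorial t (mult lam j)) (N + 1), vLam]
  simp only [vNum_eq_qFactorial ht]
  refine Finset.prod_subset (fun j hj => ?_) fun j _ hj => ?_
  · obtain ⟨i, -, rfl⟩ := Finset.mem_image.mp hj
    exact Finset.mem_range.mpr (Nat.lt_succ_of_le (hN i))
  · have : mult lam j = 0 := by
      rw [mult, Finset.card_eq_zero, Finset.filter_eq_empty_iff]
      exact fun i _ e => hj (Finset.mem_image.mpr ⟨i, Finset.mem_univ i, e⟩)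
    simp [this, qFactorial]

theorem ZR_eq_vLam_mul_ZP {K : Type*} [Field K] {r N : ℕ} {lam : Fin r → ℕ} (hN : ∀ i, lam i ≤ N)
    (z : Fin r → K) {t : K} (ht : t ≠ 1) (ht' : ∀ n, qFactorial t n ≠ 0) :
    ZR N lam z t = vLam lam t * ZP N lam z t := by
  rw [ZR, ZP, partitionFunction, partitionFunction, mul_finsum,
    vLam_eq_prod hN ht]
  exact finsum_congr fun s => s.weightR_eq_mul_weightP z ht'

/-! ### Change of rings and the generic point -/

section Map

variable {A B : Type*} [CommRing A] [CommRing B] (φ : A →+* B) {r N : ℕ} (lam : Fin r → ℕ)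
  (z : Fin r → A) (t : A)

theorem map_ZP : φ (ZP N lam z t) = ZP N lam (fun i => φ (z i)) (φ t) := by
  rw [ZP, ZP, partitionFunction, partitionFunction,
    map_finsum φ (finite_support_weightP z t)]
  refine finsum_congr fun s => ?_
  simp only [State.weight, map_prod]
  refine Finset.prod_congr rfl fun i _ => Finset.prod_congr rfl fun j _ => ?_
  cases s.h i j.succ <;> cases s.h i j.castSucc <;> simp only [weightP] <;> split_ifs <;> simp

theorem map_ZR : φ (ZR N lam z t) = ZR N lam (fun i => φ (z i)) (φ t) := by
  rw [ZR, ZR, partitionFunction, partitionFunction,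
    map_finsum φ (finite_support_weightR z t)]
  refine finsum_congr fun s => ?_
  simp only [State.weight, map_prod]
  refine Finset.prod_congr rfl fun i _ => Finset.prod_congr rfl fun j _ => ?_
  cases s.h i j.succ <;> cases s.h i j.castSucc <;> simp only [weightR] <;> split_ifs <;>
    simp [qInt]

end Map

section RatField

theorem genZ_ne_zero (r : ℕ) (i : Fin r) : genZ r i ≠ 0 := by
  rw [genZ, ne_eq, FaithfulSMul.algebraMap_eq_zero_iff]
  exact MvPolynomial.X_ne_zero i

theorem genZ_injective (r : ℕ) : Function.Injective (genZ r) :=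
  (FaithfulSMul.algebraMap_injective _ _).comp MvPolynomial.X_injective

theorem genT_pow_ne_one (r : ℕ) {n : ℕ} (hn : n ≠ 0) : genT r ^ n ≠ 1 := by
  rw [genT, ← map_pow, ← map_pow, ← map_one (algebraMap (MvPolynomial (Fin r) (Polynomial ℤ)) _),
    ← map_one (MvPolynomial.C)]
  intro h
  have h' := congrArg Polynomial.natDegree
    (MvPolynomial.C_injective _ _ (FaithfulSMul.algebraMap_injective _ _ h))
  simp [hn] at h'

theorem genT_ne_one (r : ℕ) : genT r ≠ 1 := by
  simpa using genT_pow_ne_one r one_ne_zero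

theorem qFactorial_genT_ne_zero (r n : ℕ) : qFactorial (genT r) n ≠ 0 := by
  refine Finset.prod_ne_zero_iff.mpr fun i _ => ?_
  rw [qInt_eq_div (genT_ne_one r)]
  exact div_ne_zero (sub_ne_zero.mpr (genT_pow_ne_one r (Nat.succ_ne_zero i)).symm)
    (sub_ne_zero.mpr (genT_ne_one r).symm)

end RatField

end BosonicModel

open BosonicModel in
theorem mainTheorem7 (r N : ℕ) (lam : Fin r → ℕ) (hlam : Antitone lam)
    (hN : ∀ i, lam i ≤ N) :
    -- the identities in the field of rational functions in the `z_i` and `t`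
    (ZP N lam (genZ r) (genT r) = hallLittlewoodP lam ∧
      ZR N lam (genZ r) (genT r) = hallLittlewoodR lam) ∧
    -- `P_lam` and `R_lam` are polynomials, and the identities hold at all values of `z` and `t`
    ∃ P R : MvPolynomial (Fin r) (Polynomial ℤ),
      algebraMap _ (RatField r) P = hallLittlewoodP lam ∧
      algebraMap _ (RatField r) R = hallLittlewoodR lam ∧
      ∀ (K : Type*) [CommRing K] (z : Fin r → K) (t : K),
        ZP N lam z t = evalAt z t P ∧ ZR N lam z t = evalAt z t R := by
  have hR : ZR N lam (genZ r) (genT r) = hallLittlewoodR lam :=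
    ZR_eq_hallLittlewoodSum hlam hN _ _ (genZ_ne_zero r) (genZ_injective r)
  have hv : vLam lam (genT r) ≠ 0 := by
    rw [vLam_eq_prod hN (genT_ne_one r)]
    exact Finset.prod_ne_zero_iff.mpr fun _ _ => qFactorial_genT_ne_zero r _
  have hP : ZP N lam (genZ r) (genT r) = hallLittlewoodP lam := by
    rw [hallLittlewoodP, ← hR, ZR_eq_vLam_mul_ZP hN _ (genT_ne_one r) (qFactorial_genT_ne_zero r),
      inv_mul_cancel_left₀ hv]
  -- The required polynomials are the partition functions over the polynomial ring itself, evaluated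
  -- at its indeterminates.
  refine ⟨⟨hP, hR⟩, ZP N lam MvPolynomial.X (MvPolynomial.C Polynomial.X),
    ZR N lam MvPolynomial.X (MvPolynomial.C Polynomial.X), ?_, ?_, fun K _ z t => ?_⟩
  · rw [map_ZP, ← hP]; rfl
  · rw [map_ZR, ← hR]; rfl
  · have e : ∀ p, evalAt z t p = MvPolynomial.eval₂Hom
        (Polynomial.eval₂RingHom (Int.castRingHom K) t) z p := fun _ => rfl
    rw [e, e, map_ZP, map_ZR]
    simp
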